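/- For complex $a,q$ and an integer $n\ge 0$ write $(a;q)_n=\prod_{k=0}^{n-1}(1-aq^k)$. Let $q\in\mathbb{C}$ with $|q|<1$. Then all of the series below converge absolutely, and the following four identities hold: $$\sum_{n=0}^{\infty}\frac{(1-q^{n+1})(q^3;q^3)_n(-1)^nq^{n(n+1)/2}}{(q;q)_{2n+2}}=\sum_{r=0}^{\infty}q^{9r^2+3r}(1-q^{12r+6})+\sum_{r=0}^{\infty}q^{9r^2+12r+4}(1-q^{-6r-3}),$$ $$\sum_{n=0}^{\infty}\frac{(-1)^nq^{n^2+n}}{(-q;q)_{2n}}=\sum_{r=0}^{\infty}q^{10r^2+r}(1-q^{18r+9})+\sum_{r=0}^{\infty}q^{10r^2+11r+3}(1-q^{-2r-1}),$$ $$\sum_{n=0}^{\infty}\frac{(q;q)_{n+1}(-q^2;q^2)_n(-1)^nq^{(n^2+n)/2}}{(q;q)_{2n+2}}=\sum_{r=0}^{\infty}q^{16r^2+4r}(1-q^{24r+12})-\sum_{r=0}^{\infty}q^{16r^2+8r+1}(1-q^{16r+8})+\sum_{r=0}^{\infty}q^{16r^2+12r+2}(1-q^{8r+4}),$$ $$\sum_{n=0}^{\infty}\frac{(-q;q)_nq^{n(n+1)/2}(-1)^n}{(q;q^2)_{n+1}}=\sum_{r=0}^{\infty}(-1)^rq^{r^2+r}.$$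 (For $q=0$, the terms $q^{9r^2+12r+4}(1-q^{-6r-3})$ and $q^{10r^2+11r+3}(1-q^{-2r-1})$ are read as $q^{9r^2+12r+4}-q^{9r^2+6r+1}$ and $q^{10r^2+11r+3}-q^{10r^2+9r+2}$, that is, as $0$.) -/

import Mathlib

/-- The `q`-shifted factorial `(a;q)_n = (1 - a)(1 - a q) ⋯ (1 - a q^(n-1))`. -/
def qPoch (a q : ℂ) (n : ℕ) : ℂ :=
  ∏ k ∈ Finset.range n, (1 - a * q ^ k)

open Finset Filter Topology

/-! ### Elementary facts on `q`-shifted factorials -/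

/-! All four identities come from one limiting case of Bailey's lemma (`bailey_lemma`). Write K(n,r)
for `baileyKernel`. The weights (q;q)_n (-1)^n q^{n(n+1)/2} have column sums (-1)^r q^{r(r+1)/2}
against K (`hasSum_baileyWeight_mul_kernel`). Hence, if β_n = ∑_r α_r K(n,r), exchanging summations
turns the weighted sum of β into ∑ (-1)^r q^{r(r+1)/2} α_r.

It remains to supply pairs (α, β). The finite triple product gives β_n = (xq;q)_n (q/x;q)_n /
(q;q)_{2n+1}, where only X = x + 1/x enters; x = -1 yields the fourth identity. Dividing this β_n by
1 + q^{n+1} gives a second pair; x a primitive cube root of unity and x = i yield the first and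
third. A pentagonal pair in base q^2 yields the second. For these last three, splitting r modulo 3,
4 and 2 separates the theta series.

Each pair is proved by a first-order recursion in n. The difference of its two sides is a sum over r
whose partial sums have a closed form, and that form vanishes at the top because K(n,r) = 0 for r >
n. -/

theorem qPoch_zero (a q : ℂ) : qPoch a q 0 = 1 := by simp [qPoch]

theorem qPoch_succ (a q : ℂ) (n : ℕ) : qPoch a q (n + 1) = qPoch a q n * (1 - a * q ^ n) := by
  simp [qPoch, Finset.prod_range_succ]

theorem qPoch_self_succ (q : ℂ) (n : ℕ) :
    qPoch q q (n + 1) = qPoch q q n * (1 - q ^ (n + 1)) := by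
  rw [qPoch_succ, pow_succ']

theorem one_sub_pow_ne_zero {q : ℂ} (hq : ‖q‖ < 1) (n : ℕ) : 1 - q ^ (n + 1) ≠ 0 := by
  intro h
  have h1 : q ^ (n + 1) = 1 := (sub_eq_zero.mp h).symm
  have h2 : ‖q‖ ^ (n + 1) < 1 := pow_lt_one₀ (norm_nonneg _) hq (Nat.succ_ne_zero n)
  rw [← norm_pow, h1, norm_one] at h2
  exact lt_irrefl _ h2

theorem qPoch_self_ne_zero {q : ℂ} (hq : ‖q‖ < 1) (n : ℕ) : qPoch q q n ≠ 0 := by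
  induction n with
  | zero => simp [qPoch_zero]
  | succ n ih => rw [qPoch_self_succ]; exact mul_ne_zero ih (one_sub_pow_ne_zero hq n)

theorem norm_qPoch_self_le {q : ℂ} (hq : ‖q‖ < 1) (n : ℕ) : ‖qPoch q q n‖ ≤ 2 ^ n := by
  induction n with
  | zero => simp [qPoch_zero]
  | succ n ih =>
    rw [qPoch_self_succ, norm_mul, pow_succ (2 : ℝ)]
    refine mul_le_mul ih ?_ (norm_nonneg _) (by positivity)
    calc ‖1 - q ^ (n + 1)‖ ≤ ‖(1 : ℂ)‖ + ‖q ^ (n + 1)‖ := norm_sub_le _ _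
      _ ≤ 1 + 1 := by
        rw [norm_one, norm_pow]
        gcongr
        exact pow_le_one₀ (norm_nonneg _) hq.le
      _ = 2 := by norm_num

theorem one_sub_norm_le_norm_one_sub_pow {q : ℂ} (hq : ‖q‖ < 1) (n : ℕ) :
    1 - ‖q‖ ≤ ‖1 - q ^ (n + 1)‖ := by
  have h1 : ‖(1 : ℂ)‖ - ‖q ^ (n + 1)‖ ≤ ‖1 - q ^ (n + 1)‖ := norm_sub_norm_le _ _
  rw [norm_one, norm_pow] at h1
  have h2 : ‖q‖ ^ (n + 1) ≤ ‖q‖ := pow_le_of_le_one (norm_nonneg _) hq.le (Nat.succ_ne_zero n)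
  linarith

theorem one_sub_norm_le_norm_one_add_pow {q : ℂ} (hq : ‖q‖ < 1) (n : ℕ) :
    1 - ‖q‖ ≤ ‖1 + q ^ n‖ := by
  cases n with
  | zero =>
    have := norm_nonneg q
    norm_num
    linarith
  | succ n =>
    have h1 : ‖(1 : ℂ)‖ - ‖-q ^ (n + 1)‖ ≤ ‖1 - -q ^ (n + 1)‖ := norm_sub_norm_le _ _
    rw [sub_neg_eq_add, norm_neg, norm_one, norm_pow] at h1
    have h2 : ‖q‖ ^ (n + 1) ≤ ‖q‖ := pow_le_of_le_one (norm_nonneg _) hq.le (Nat.succ_ne_zero n)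
    linarith

theorem one_add_pow_ne_zero {q : ℂ} (hq : ‖q‖ < 1) (n : ℕ) : 1 + q ^ n ≠ 0 := by
  have h := one_sub_norm_le_norm_one_add_pow hq n
  exact norm_pos_iff.mp (by linarith)

theorem norm_qPoch_self_inv_le {q : ℂ} (hq : ‖q‖ < 1) (n : ℕ) :
    ‖(qPoch q q n)⁻¹‖ ≤ (1 - ‖q‖)⁻¹ ^ n := by
  have h0 : 0 < 1 - ‖q‖ := by linarith
  induction n with
  | zero => simp [qPoch_zero]
  | succ n ih =>
    rw [qPoch_self_succ, mul_inv, norm_mul, pow_succ (1 - ‖q‖)⁻¹]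
    refine mul_le_mul ih ?_ (norm_nonneg _) (by positivity)
    rw [norm_inv]
    exact inv_anti₀ h0 (one_sub_norm_le_norm_one_sub_pow hq n)

/-- Triangular numbers satisfy the expected recursion. -/
theorem triangle_succ (n : ℕ) : (n + 1) * (n + 1 + 1) / 2 = n * (n + 1) / 2 + (n + 1) := by
  have : (n + 1) * (n + 1 + 1) = n * (n + 1) + (n + 1) * 2 := by ring
  rw [this, Nat.add_mul_div_right _ _ (by norm_num)]

theorem two_mul_triangle (n : ℕ) : 2 * (n * (n + 1) / 2) = n ^ 2 + n := by
  rw [Nat.mul_div_cancel' (Nat.even_mul_succ_self n).two_dvd]; ring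

/-! ### The Bailey kernel and the conjugate Bailey pair -/

/-- The Bailey kernel `1 / ((q;q)_{n-r} (q;q)_{n+r+1})`, extended by zero to `r > n`. -/
noncomputable def baileyKernel (q : ℂ) (n r : ℕ) : ℂ :=
  if r ≤ n then (qPoch q q (n - r) * qPoch q q (n + r + 1))⁻¹ else 0

/-- The weight `(q;q)_n (-1)^n q^{n(n+1)/2}`. -/
noncomputable def baileyWeight (q : ℂ) (n : ℕ) : ℂ :=
  qPoch q q n * (-1) ^ n * q ^ (n * (n + 1) / 2)

theorem baileyKernel_of_lt (q : ℂ) {n r : ℕ} (h : n < r) : baileyKernel q n r = 0 := by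
  simp [baileyKernel, h]

theorem baileyKernel_add (q : ℂ) (r s : ℕ) :
    baileyKernel q (r + s) r = (qPoch q q s * qPoch q q (2 * r + s + 1))⁻¹ := by
  have : r + s + r + 1 = 2 * r + s + 1 := by ring
  simp [baileyKernel, this]

theorem baileyKernel_step_fst {q : ℂ} (hq : ‖q‖ < 1) (r s : ℕ) :
    baileyKernel q (r + s) r =
      (1 - q ^ (s + 1)) * (1 - q ^ (2 * r + s + 2)) * baileyKernel q (r + s + 1) r := by
  rw [add_assoc r s 1, baileyKernel_add, baileyKernel_add, ← add_assoc (2 * r) s 1,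
    qPoch_self_succ q s, qPoch_self_succ q (2 * r + s + 1)]
  have h1 := qPoch_self_ne_zero hq s
  have h2 := qPoch_self_ne_zero hq (2 * r + s + 1)
  have h3 := one_sub_pow_ne_zero hq s
  have h4 := one_sub_pow_ne_zero hq (2 * r + s + 1)
  field_simp

theorem baileyKernel_step_snd {q : ℂ} (hq : ‖q‖ < 1) (r s : ℕ) :
    (1 - q ^ (2 * r + s + 2)) * baileyKernel q (r + s) (r + 1) =
      (1 - q ^ s) * baileyKernel q (r + s) r := by
  cases s with
  | zero => rw [baileyKernel_of_lt q (show r + 0 < r + 1 by omega)]; simp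
  | succ s =>
    rw [show r + (s + 1) = (r + 1) + s by ring, baileyKernel_add,
      show r + 1 + s = r + (s + 1) by ring, baileyKernel_add,
      show 2 * (r + 1) + s + 1 = 2 * r + (s + 1) + 1 + 1 by ring, qPoch_self_succ q s,
      qPoch_self_succ q (2 * r + (s + 1) + 1)]
    have h1 := qPoch_self_ne_zero hq s
    have h2 := qPoch_self_ne_zero hq (2 * r + (s + 1) + 1)
    have h3 := one_sub_pow_ne_zero hq s
    have h4 := one_sub_pow_ne_zero hq (2 * r + (s + 1) + 1)
    field_simp

theorem baileyWeight_succ (q : ℂ) (n : ℕ) :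
    baileyWeight q (n + 1) = -(q ^ (n + 1) * (1 - q ^ (n + 1))) * baileyWeight q n := by
  rw [baileyWeight, baileyWeight, triangle_succ, qPoch_self_succ, pow_add q]
  ring

/-- The partial sums giving the two-term recursion of the conjugate Bailey pair. -/
theorem sum_range_baileyWeight_mul_kernel {q : ℂ} (hq : ‖q‖ < 1) (r N : ℕ) :
    ∑ n ∈ range N, baileyWeight q n *
        (q ^ (r + 1) * baileyKernel q n r + baileyKernel q n (r + 1)) =
      -((1 + q ^ (r + 1)) * (1 - q ^ (N - r)) * (baileyWeight q N * baileyKernel q N r)) := by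
  induction N with
  | zero =>
    rcases Nat.eq_zero_or_pos r with rfl | h
    · simp
    · simp [baileyKernel_of_lt q h]
  | succ N ih =>
    rw [sum_range_succ, ih]
    rcases lt_or_ge N r with h | h
    -- When N + 1 = r the kernel K(r,r) is nonzero; the right side vanishes because the factor 1 -
    -- q^0 does.
    · rw [baileyKernel_of_lt q h, baileyKernel_of_lt q (show N < r + 1 by omega),
        show N + 1 - r = 0 by omega]
      simp
    · obtain ⟨s, rfl⟩ := Nat.exists_eq_add_of_le h
      have e1 := baileyKernel_step_fst hq r s
      have e2 := baileyKernel_step_snd hq r s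
      have h4 := one_sub_pow_ne_zero hq (2 * r + s + 1)
      have e3 : baileyKernel q (r + s) (r + 1) =
          (1 - q ^ s) * (1 - q ^ (s + 1)) * baileyKernel q (r + s + 1) r := by
        apply mul_left_cancel₀ h4
        rw [e2, e1]; ring
      rw [e3, e1, baileyWeight_succ, show r + s - r = s by omega,
        show r + s + 1 - r = s + 1 by omega]
      ring

theorem norm_baileyWeight_le {q : ℂ} (hq : ‖q‖ < 1) (n : ℕ) :
    ‖baileyWeight q n‖ ≤ 2 ^ n * ‖q‖ ^ (n * (n + 1) / 2) := by
  rw [baileyWeight, norm_mul, norm_mul, norm_pow (-1 : ℂ), norm_neg, norm_one, one_pow, mul_one,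
    norm_pow]
  gcongr
  exact norm_qPoch_self_le hq n

theorem norm_baileyKernel_le {q : ℂ} (hq : ‖q‖ < 1) {n r : ℕ} (h : r ≤ n) :
    ‖baileyKernel q n r‖ ≤ (1 - ‖q‖)⁻¹ ^ (2 * n + 1) := by
  have h0 : 0 < 1 - ‖q‖ := by linarith
  rw [baileyKernel, if_pos h, mul_inv, norm_mul, show 2 * n + 1 = (n - r) + (n + r + 1) by omega,
    pow_add]
  gcongr
  · exact norm_qPoch_self_inv_le hq _
  · exact norm_qPoch_self_inv_le hq _

theorem summable_pow_mul_pow_triangle {t : ℝ} (C : ℝ) (ht0 : 0 ≤ t) (ht : t < 1) :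
    Summable fun n : ℕ => C ^ n * t ^ (n * (n + 1) / 2) := by
  have hlim : Tendsto (fun n : ℕ => |C| * t ^ (n + 1)) atTop (𝓝 (|C| * 0)) :=
    ((tendsto_pow_atTop_nhds_zero_of_lt_one ht0 ht).comp (tendsto_add_atTop_nat 1)).const_mul _
  rw [mul_zero] at hlim
  refine summable_of_ratio_norm_eventually_le (r := 1 / 2) (by norm_num) ?_
  filter_upwards [hlim.eventually (gt_mem_nhds (show (0 : ℝ) < 1 / 2 by norm_num))] with n hn
  rw [triangle_succ, pow_add t, pow_succ C, show C ^ n * C * (t ^ (n * (n + 1) / 2) * t ^ (n + 1)) =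
    (C * t ^ (n + 1)) * (C ^ n * t ^ (n * (n + 1) / 2)) by ring, norm_mul]
  gcongr
  rw [norm_mul, Real.norm_eq_abs, Real.norm_of_nonneg (by positivity)]
  exact hn.le

/-- The factor (1/2)^r makes the bound a product of a summable function of n and one of r. It costs
2^n, since 1 ≤ 2^n (1/2)^r on the support r ≤ n; with the 2^n bounding (q;q)_n this gives the 4. -/
theorem norm_baileyWeight_mul_kernel_le {q : ℂ} (hq : ‖q‖ < 1) (n r : ℕ) :
    ‖baileyWeight q n * baileyKernel q n r‖ ≤ (1 - ‖q‖)⁻¹ *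
      ((4 * (1 - ‖q‖)⁻¹ ^ 2) ^ n * ‖q‖ ^ (n * (n + 1) / 2)) * (1 / 2) ^ r := by
  have h0 : 0 < 1 - ‖q‖ := by linarith
  rcases lt_or_ge n r with h | h
  · rw [baileyKernel_of_lt q h, mul_zero, norm_zero]; positivity
  · have h1 : (1 : ℝ) ≤ 2 ^ n * (1 / 2) ^ r := by
      rw [one_div, inv_pow, ← div_eq_mul_inv, one_le_div (by positivity)]
      exact pow_le_pow_right₀ (by norm_num) h
    calc ‖baileyWeight q n * baileyKernel q n r‖
        ≤ (2 ^ n * ‖q‖ ^ (n * (n + 1) / 2)) * (1 - ‖q‖)⁻¹ ^ (2 * n + 1) := by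
          rw [norm_mul]
          exact mul_le_mul (norm_baileyWeight_le hq n) (norm_baileyKernel_le hq h)
            (norm_nonneg _) (by positivity)
      _ ≤ (2 ^ n * ‖q‖ ^ (n * (n + 1) / 2)) * (1 - ‖q‖)⁻¹ ^ (2 * n + 1) *
            (2 ^ n * (1 / 2) ^ r) := le_mul_of_one_le_right (by positivity) h1
      _ = _ := by
        rw [mul_pow, ← pow_mul, pow_succ, show (4 : ℝ) = 2 * 2 by norm_num, mul_pow]; ring

theorem summable_baileyWeight_mul_kernel {q : ℂ} (hq : ‖q‖ < 1) (r : ℕ) :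
    Summable fun n => baileyWeight q n * baileyKernel q n r :=
  Summable.of_norm_bounded
    (((summable_pow_mul_pow_triangle _ (norm_nonneg q) hq).mul_left _).mul_right _)
    fun n => norm_baileyWeight_mul_kernel_le hq n r

/-- The conjugate Bailey pair: the weighted column sums of the Bailey kernel. -/
theorem hasSum_baileyWeight_mul_kernel {q : ℂ} (hq : ‖q‖ < 1) (r : ℕ) :
    HasSum (fun n => baileyWeight q n * baileyKernel q n r)
      ((-1) ^ r * q ^ (r * (r + 1) / 2)) := by
  have hzero : ∀ r, Tendsto (fun n => baileyWeight q n * baileyKernel q n r) atTop (𝓝 0) :=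
    fun r => (summable_baileyWeight_mul_kernel hq r).tendsto_atTop_zero
  induction r with
  | zero =>
    rw [(summable_baileyWeight_mul_kernel hq 0).hasSum_iff_tendsto_nat]
    have hpart : ∀ N, ∑ n ∈ range N, baileyWeight q n * baileyKernel q n 0 =
        1 - (1 - q ^ (N + 1)) * (baileyWeight q N * baileyKernel q N 0) := by
      have key : ∀ N, baileyKernel q N 0 =
          (1 - q ^ (N + 1)) * (1 - q ^ (N + 2)) * baileyKernel q (N + 1) 0 := fun N => by
        simpa using baileyKernel_step_fst hq 0 N
      intro N
      induction N with
      | zero =>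
        have h := one_sub_pow_ne_zero hq 0
        rw [zero_add, pow_one] at h
        simp [baileyKernel, baileyWeight, qPoch, h]
      | succ N ih =>
        rw [sum_range_succ, ih, key, baileyWeight_succ]
        ring
    simp_rw [hpart]
    have h1 : Tendsto (fun N : ℕ => q ^ (N + 1)) atTop (𝓝 0) :=
      (tendsto_pow_atTop_nhds_zero_of_norm_lt_one hq).comp (tendsto_add_atTop_nat 1)
    simpa using ((h1.const_sub 1).mul (hzero 0)).const_sub 1
  | succ r ih =>
    have hs := summable_baileyWeight_mul_kernel hq (r + 1)
    have h1 : Tendsto (fun N : ℕ => q ^ (N - r)) atTop (𝓝 0) :=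
      (tendsto_pow_atTop_nhds_zero_of_norm_lt_one hq).comp (tendsto_sub_atTop_nat r)
    -- With γ_r the r-th column sum, this reads q^{r+1} γ_r + γ_{r+1} = 0.
    have h2 : HasSum (fun n => baileyWeight q n *
        (q ^ (r + 1) * baileyKernel q n r + baileyKernel q n (r + 1))) 0 := by
      have hsum : Summable (fun n => baileyWeight q n *
          (q ^ (r + 1) * baileyKernel q n r + baileyKernel q n (r + 1))) :=
        (((summable_baileyWeight_mul_kernel hq r).mul_left (q ^ (r + 1))).add hs).congr
          fun n => by ring
      rw [hsum.hasSum_iff_tendsto_nat]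
      simp_rw [sum_range_baileyWeight_mul_kernel hq]
      simpa using ((((h1.const_sub 1).const_mul (1 + q ^ (r + 1))).mul (hzero r))).neg
    have h3 := h2.sub (ih.mul_left (q ^ (r + 1)))
    have h4 : (-1) ^ (r + 1) * q ^ ((r + 1) * (r + 1 + 1) / 2) =
        0 - q ^ (r + 1) * ((-1) ^ r * q ^ (r * (r + 1) / 2)) := by
      rw [triangle_succ, pow_add q]; ring
    rw [h4]
    refine (congrArg (HasSum · _) (funext fun n => ?_)).mp h3
    ring

/-- A case of Bailey's lemma relative to `a = q`, with one parameter equal to `q` and the other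
tending to infinity. -/
theorem bailey_lemma {q : ℂ} (hq : ‖q‖ < 1) {α β : ℕ → ℂ} {A : ℝ} (hα : ∀ r, ‖α r‖ ≤ A)
    (hβ : ∀ n, ∑ r ∈ range (n + 1), α r * baileyKernel q n r = β n) :
    HasSum (fun n => baileyWeight q n * β n)
      (∑' r, (-1) ^ r * q ^ (r * (r + 1) / 2) * α r) := by
  have hA : 0 ≤ A := (norm_nonneg _).trans (hα 0)
  have hgeom : Summable fun r : ℕ => ((1 : ℝ) / 2) ^ r := summable_geometric_two
  have h0 : 0 < 1 - ‖q‖ := by linarith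
  -- Joint summability, which licenses the exchange of the two sums.
  have hs : Summable fun x : ℕ × ℕ =>
      baileyWeight q x.1 * baileyKernel q x.1 x.2 * α x.2 := by
    refine Summable.of_norm_bounded
      ((((summable_pow_mul_pow_triangle (4 * (1 - ‖q‖)⁻¹ ^ 2) (norm_nonneg q) hq).mul_left
        (1 - ‖q‖)⁻¹).mul_of_nonneg hgeom (fun n => by positivity)
        (fun n => by positivity)).mul_right A) fun x => ?_
    rw [norm_mul]
    exact mul_le_mul (norm_baileyWeight_mul_kernel_le hq x.1 x.2) (hα x.2) (norm_nonneg _)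
      (by positivity)
  have hrow : ∀ n, ∑' r, baileyWeight q n * baileyKernel q n r * α r =
      baileyWeight q n * β n := by
    intro n
    rw [← hβ, mul_sum, tsum_eq_sum (s := range (n + 1))]
    · exact sum_congr rfl fun r _ => by ring
    · intro r hr
      rw [baileyKernel_of_lt q (by rw [Finset.mem_range] at hr; omega)]
      ring
  have hcol : ∀ r, ∑' n, baileyWeight q n * baileyKernel q n r * α r =
      (-1) ^ r * q ^ (r * (r + 1) / 2) * α r := fun r =>
    ((hasSum_baileyWeight_mul_kernel hq r).mul_right (α r)).tsum_eq
  have h1 := hs.prod.hasSum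
  simp only [hrow] at h1
  have h2 : ∑' r, (-1) ^ r * q ^ (r * (r + 1) / 2) * α r = ∑' n, baileyWeight q n * β n := by
    rw [← tsum_congr hcol, ← tsum_congr hrow]
    exact hs.tsum_comm (f := fun n r => baileyWeight q n * baileyKernel q n r * α r)
  rwa [h2]

/-! ### Bailey pairs -/

theorem baileyKernel_pred {q : ℂ} (hq : ‖q‖ < 1) {n r s : ℕ} (h : n + 1 = r + s) :
    baileyKernel q n r =
      (1 - q ^ s) * (1 - q ^ (2 * r + s + 1)) * baileyKernel q (n + 1) r := by
  cases s with
  | zero => rw [baileyKernel_of_lt q (show n < r by omega)]; simp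
  | succ s =>
    obtain rfl : n = r + s := by omega
    exact baileyKernel_step_fst hq r s

theorem baileyKernel_diag {q : ℂ} (hq : ‖q‖ < 1) (r s : ℕ) :
    baileyKernel q (r + s) r = (1 - q ^ (2 * r + s + 2)) * (1 - q ^ (2 * r + s + 3)) *
      baileyKernel q (r + s + 1) (r + 1) := by
  rw [show r + s + 1 = r + 1 + s by ring, baileyKernel_add, baileyKernel_add,
    show 2 * (r + 1) + s + 1 = 2 * r + s + 1 + 1 + 1 by ring,
    qPoch_self_succ q (2 * r + s + 1 + 1), qPoch_self_succ q (2 * r + s + 1)]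
  have h1 := qPoch_self_ne_zero hq s
  have h2 := qPoch_self_ne_zero hq (2 * r + s + 1)
  have h3 := one_sub_pow_ne_zero hq (2 * r + s + 1)
  have h4 := one_sub_pow_ne_zero hq (2 * r + s + 1 + 1)
  field_simp

theorem baileyKernel_antidiag {q : ℂ} (hq : ‖q‖ < 1) (r s : ℕ) :
    baileyKernel q (r + s) (r + 1) =
      (1 - q ^ s) * (1 - q ^ (s + 1)) * baileyKernel q (r + s + 1) r := by
  apply mul_left_cancel₀ (one_sub_pow_ne_zero hq (2 * r + s + 1))
  rw [baileyKernel_step_snd hq, baileyKernel_step_fst hq]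
  ring

/-- The product `∏_{k=1}^n (1 - X q^k + q^{2k})`, that is `(xq;q)_n (q/x;q)_n` for
`X = x + 1/x`. -/
noncomputable def quadProd (X q : ℂ) (n : ℕ) : ℂ :=
  ∏ k ∈ range n, (1 - X * q ^ (k + 1) + q ^ (2 * (k + 1)))

theorem quadProd_succ (X q : ℂ) (n : ℕ) :
    quadProd X q (n + 1) = quadProd X q n * (1 - X * q ^ (n + 1) + q ^ (2 * (n + 1))) := by
  simp [quadProd, prod_range_succ]

/-- Telescoping certificate for (1 - q^{2n+2})(1 - q^{2n+3}) β_{n+1} = (1 - X q^{n+1} + q^{2n+2})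
β_n; both boundary terms vanish at R = n + 1. For X = x + 1/x and d 0 = 1, d r is the sum of x^j
over |j| ≤ r. -/
theorem sum_range_quadProd_recursion {q X : ℂ} (hq : ‖q‖ < 1) {d : ℕ → ℂ}
    (h1 : d 1 = (1 + X) * d 0) (hd : ∀ r, d (r + 2) = X * d (r + 1) - d r) {n R : ℕ}
    (hR : R ≤ n + 1) :
    ∑ r ∈ range (R + 1), (-1) ^ r * q ^ (r * (r + 1) / 2) * d r *
        ((1 - q ^ (2 * n + 2)) * (1 - q ^ (2 * n + 3)) * baileyKernel q (n + 1) r -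
          (1 - X * q ^ (n + 1) + q ^ (2 * (n + 1))) * baileyKernel q n r) =
      q ^ (n + 1) * (-1) ^ R * q ^ (R * (R + 1) / 2) *
        (baileyKernel q n R * d (R + 1) + q ^ (R + 1) * baileyKernel q n (R + 1) * d R) := by
  induction R with
  | zero =>
    have e1 := baileyKernel_step_fst hq 0 n
    have e2 := baileyKernel_antidiag hq 0 n
    simp only [zero_add, mul_zero] at e1 e2
    simp only [zero_add, range_one, sum_singleton, e1, e2, h1]
    simp only [pow_zero, one_mul, Nat.zero_div, mul_one, pow_one]
    ring
  | succ R ih =>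
    rw [sum_range_succ, ih (by omega), triangle_succ, pow_add q, hd]
    obtain ⟨s, rfl⟩ := Nat.exists_eq_add_of_le (show R ≤ n by omega)
    have e1 := baileyKernel_pred hq (show R + s + 1 = (R + 1) + s by ring)
    have e2 := baileyKernel_diag hq R s
    rw [e1, e2]
    cases s with
    | zero =>
      rw [baileyKernel_of_lt q (show R + 0 < R + 1 + 1 by omega)]
      ring
    | succ s =>
      have e3 := baileyKernel_antidiag hq (R + 1) s
      rw [show R + 1 + s = R + (s + 1) by ring] at e3
      rw [e3]
      ring

/-- The Bailey pair coming from the finite form of the Jacobi triple product. -/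
theorem sum_baileyKernel_eq_quadProd {q X : ℂ} (hq : ‖q‖ < 1) {d : ℕ → ℂ} (h0 : d 0 = 1)
    (h1 : d 1 = 1 + X) (hd : ∀ r, d (r + 2) = X * d (r + 1) - d r) (n : ℕ) :
    ∑ r ∈ range (n + 1), (-1) ^ r * q ^ (r * (r + 1) / 2) * d r * baileyKernel q n r =
      quadProd X q n / qPoch q q (2 * n + 1) := by
  induction n with
  | zero => simp [baileyKernel, quadProd, h0, qPoch_zero]
  | succ n ih =>
    have h := sum_range_quadProd_recursion hq (by rw [h1, h0, mul_one]) hd (le_refl (n + 1))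
    rw [baileyKernel_of_lt q (show n < n + 1 by omega),
      baileyKernel_of_lt q (show n < n + 1 + 1 by omega)] at h
    have hS : ∑ r ∈ range (n + 1 + 1), (-1) ^ r * q ^ (r * (r + 1) / 2) * d r *
        baileyKernel q n r = quadProd X q n / qPoch q q (2 * n + 1) := by
      rw [sum_range_succ, baileyKernel_of_lt q (show n < n + 1 by omega), mul_zero, add_zero, ih]
    have e1 : qPoch q q (2 * (n + 1) + 1) =
        (1 - q ^ (2 * n + 2)) * (1 - q ^ (2 * n + 3)) * qPoch q q (2 * n + 1) := by
      rw [show 2 * (n + 1) + 1 = 2 * n + 1 + 1 + 1 by ring, qPoch_self_succ, qPoch_self_succ]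
      ring
    have hne := mul_ne_zero (one_sub_pow_ne_zero hq (2 * n + 1)) (one_sub_pow_ne_zero hq (2 * n + 2))
    rw [quadProd_succ, e1, mul_comm (quadProd X q n), mul_div_mul_comm, ← hS, div_mul_eq_mul_div,
      eq_div_iff hne, ← sub_eq_zero, mul_sum, sum_mul, ← sum_sub_distrib]
    refine Eq.trans (sum_congr rfl fun r _ => ?_) (h.trans (by ring))
    ring

/-- Compares 1 + q^{n+1} times the divided pair with the triple product pair for d r = u (r+1) + u
r. The sums telescope and vanish at R = n + 1. If u 1 = 1 and u satisfies the recursion of d, then u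
r = (x^r - x^{-r})/(x - x^{-1}) for x ≠ ±1. -/
theorem sum_range_shifted_pair {q : ℂ} (hq : ‖q‖ < 1) {u : ℕ → ℂ} (h0 : u 0 = 0) {n R : ℕ}
    (hR : R ≤ n + 1) :
    ∑ r ∈ range R, (-1) ^ r * q ^ (r * (r + 1) / 2) *
        ((1 + q ^ (n + 1)) * (u (r + 1) / (1 + q ^ (r + 1)) + q ^ r * u r / (1 + q ^ r)) -
          (u (r + 1) + u r)) * baileyKernel q n r =
      (-1) ^ R * q ^ (R * (R + 1) / 2) * (u R / (1 + q ^ R)) *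
        ((1 - q ^ (n + R + 1)) * baileyKernel q n R) := by
  induction R with
  | zero => simp [h0]
  | succ R ih =>
    rw [sum_range_succ, ih (by omega)]
    obtain ⟨s, rfl⟩ := Nat.exists_eq_add_of_le (show R ≤ n by omega)
    have e := baileyKernel_step_snd hq R s
    rw [show R + s + (R + 1) + 1 = 2 * R + s + 2 by ring, e, triangle_succ, pow_add q]
    have h1 := one_add_pow_ne_zero hq (R + 1)
    have h2 := one_add_pow_ne_zero hq R
    field_simp
    ring

/-- The Bailey pair obtained by dividing the triple product pair by `1 + q^{n+1}`. -/
theorem sum_baileyKernel_eq_quadProd_div {q X : ℂ} (hq : ‖q‖ < 1) {u : ℕ → ℂ} (h0 : u 0 = 0)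
    (h1 : u 1 = 1) (hu : ∀ r, u (r + 2) = X * u (r + 1) - u r) (n : ℕ) :
    ∑ r ∈ range (n + 1), (-1) ^ r * q ^ (r * (r + 1) / 2) *
        (u (r + 1) / (1 + q ^ (r + 1)) + q ^ r * u r / (1 + q ^ r)) * baileyKernel q n r =
      quadProd X q n / (qPoch q q (2 * n + 1) * (1 + q ^ (n + 1))) := by
  have h := sum_range_shifted_pair hq h0 (le_refl (n + 1))
  rw [baileyKernel_of_lt q (show n < n + 1 by omega), mul_zero, mul_zero] at h
  have h2 := sum_baileyKernel_eq_quadProd hq (X := X) (d := fun r => u (r + 1) + u r)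
    (by simp [h0, h1]) (by simp [hu, h0, h1, add_comm]) (fun r => by simp only [hu]; ring) n
  rw [← div_div, ← h2, eq_div_iff (one_add_pow_ne_zero hq (n + 1)), sum_mul, ← sub_eq_zero,
    ← sum_sub_distrib, ← h]
  exact sum_congr rfl fun r _ => by ring

/-- The pentagonal number `r(3r-1)/2`. -/
def pentNum (r : ℕ) : ℕ := ∑ i ∈ range r, (3 * i + 1)

theorem pentNum_succ (r : ℕ) : pentNum (r + 1) = pentNum r + (3 * r + 1) := by
  simp [pentNum, sum_range_succ]

theorem two_mul_pentNum (r : ℕ) : 2 * pentNum r + r = 3 * r ^ 2 := by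
  induction r with
  | zero => simp [pentNum]
  | succ r ih => rw [pentNum_succ]; nlinarith

/-- Certificate for (1 - p^{4n+4})(1 + p^{2n+1}) β_{n+1} = β_n. The bracket is a Laurent polynomial
in p^{n+1}, p^R and p that vanishes at R = 0; the kernel vanishes at R = n + 2. -/
theorem sum_range_pentagonal_recursion {p : ℂ} (hp : ‖p‖ < 1) (hp0 : p ≠ 0) {n R : ℕ}
    (hR : R ≤ n + 2) :
    ∑ r ∈ range R, (-1) ^ r * p ^ pentNum r * (1 - p ^ (4 * r + 2)) *
        ((1 - p ^ (4 * n + 4)) * (1 + p ^ (2 * n + 1)) * baileyKernel (p ^ 2) (n + 1) r -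
          baileyKernel (p ^ 2) n r) =
      (-1) ^ R * p ^ pentNum R *
        (-(p ^ (n + 1)) ^ 2 / (p ^ R) ^ 2 - (p ^ (n + 1)) ^ 4 / p / p ^ R +
          ((p ^ (n + 1)) ^ 4 - (p ^ (n + 1)) ^ 2 / p) * (1 - p ^ R) +
          (p ^ (n + 1)) ^ 4 / p * (p ^ R) ^ 2 + (p ^ (n + 1)) ^ 2 * (p ^ R) ^ 3) *
        ((1 - (p ^ 2) ^ (n + R + 2)) * baileyKernel (p ^ 2) (n + 1) R) := by
  have hq : ‖p ^ 2‖ < 1 := by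
    rw [norm_pow]; exact pow_lt_one₀ (norm_nonneg _) hp (by norm_num)
  induction R with
  | zero => simp
  | succ R ih =>
    obtain ⟨s, hs⟩ := Nat.exists_eq_add_of_le (show R ≤ n + 1 by omega)
    have e1 := baileyKernel_pred hq hs
    have e2 := baileyKernel_step_snd hq R s
    rw [← hs] at e2
    rw [sum_range_succ, ih (by omega), e1, show n + (R + 1) + 2 = 2 * R + s + 2 by omega, e2,
      pentNum_succ, show n + R + 2 = 2 * R + s + 1 by omega,
      show 4 * n + 4 = 4 * R + 4 * s by omega]
    have e3 : p ^ (2 * n + 1) = p ^ (2 * R + 2 * s) / p := by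
      rw [eq_div_iff hp0, ← pow_succ]; congr 1; omega
    rw [e3, hs]
    have h1 : p ^ R ≠ 0 := pow_ne_zero _ hp0
    rw [pow_add p R s]
    field_simp
    ring

/-- A Bailey pair with pentagonal exponents. -/
theorem sum_baileyKernel_eq_pentagonal {p : ℂ} (hp : ‖p‖ < 1) (n : ℕ) :
    ∑ r ∈ range (n + 1), (-1) ^ r * p ^ pentNum r * (1 - p ^ (4 * r + 2)) *
        baileyKernel (p ^ 2) n r =
      (qPoch (p ^ 2) (p ^ 2) n * qPoch (-p) p (2 * n))⁻¹ := by
  have hq : ‖p ^ 2‖ < 1 := by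
    rw [norm_pow]; exact pow_lt_one₀ (norm_nonneg _) hp (by norm_num)
  rcases eq_or_ne p 0 with rfl | hp0
  -- The certificate divides by p, so p = 0 is checked directly: only r = 0 contributes.
  · rw [sum_range_succ']
    have h : ∀ r, (0 : ℂ) ^ pentNum (r + 1) = 0 := fun r =>
      zero_pow (by rw [pentNum_succ]; omega)
    simp only [h, mul_zero, zero_mul, sum_const_zero]
    simp [baileyKernel, pentNum, qPoch]
  induction n with
  | zero =>
    have := one_sub_pow_ne_zero hp 1
    norm_num at this
    simp [baileyKernel, pentNum, qPoch, this]
  | succ n ih =>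
    have h := sum_range_pentagonal_recursion hp hp0 (le_refl (n + 2))
    rw [baileyKernel_of_lt (p ^ 2) (show n + 1 < n + 2 by omega), mul_zero, mul_zero] at h
    have hS : ∑ r ∈ range (n + 1 + 1), (-1) ^ r * p ^ pentNum r * (1 - p ^ (4 * r + 2)) *
        baileyKernel (p ^ 2) n r = (qPoch (p ^ 2) (p ^ 2) n * qPoch (-p) p (2 * n))⁻¹ := by
      rw [sum_range_succ, baileyKernel_of_lt _ (show n < n + 1 by omega), mul_zero, add_zero, ih]
    have e1 : qPoch (p ^ 2) (p ^ 2) (n + 1) * qPoch (-p) p (2 * (n + 1)) =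
        (qPoch (p ^ 2) (p ^ 2) n * qPoch (-p) p (2 * n)) *
          ((1 - p ^ (4 * n + 4)) * (1 + p ^ (2 * n + 1))) := by
      rw [show 2 * (n + 1) = 2 * n + 1 + 1 by ring, qPoch_succ, qPoch_succ, qPoch_succ]
      ring
    have hne := mul_ne_zero (one_sub_pow_ne_zero hp (4 * n + 3)) (one_add_pow_ne_zero hp (2 * n + 1))
    rw [e1, mul_inv, ← hS, ← div_eq_mul_inv, eq_div_iff hne, ← sub_eq_zero, sum_mul,
      ← sum_sub_distrib, ← h]
    exact sum_congr rfl fun r _ => by ring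

/-! ### Summation of the false theta series -/

theorem summable_pow_mul_of_bounded {q : ℂ} (hq : ‖q‖ < 1) {e : ℕ → ℕ} (he : ∀ r, r ≤ e r)
    {c : ℕ → ℂ} {C : ℝ} (hc : ∀ r, ‖c r‖ ≤ C) : Summable fun r => q ^ e r * c r := by
  refine Summable.of_norm_bounded
    ((summable_geometric_of_lt_one (norm_nonneg q) hq).mul_right C) fun r => ?_
  rw [norm_mul, norm_pow]
  exact mul_le_mul (pow_le_pow_of_le_one (norm_nonneg q) hq.le (he r)) (hc r) (norm_nonneg _)
    (by positivity)

theorem summable_pow_of_le {q : ℂ} (hq : ‖q‖ < 1) {e : ℕ → ℕ} (he : ∀ r, r ≤ e r) :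
    Summable fun r => q ^ e r := by
  simpa using summable_pow_mul_of_bounded hq he (c := fun _ => 1) (C := 1) (by simp)

theorem neg_one_pow_mul_neg_one_pow (r : ℕ) : (-1 : ℂ) ^ r * (-1) ^ r = 1 := by
  rw [← mul_pow]; simp

theorem tsum_eq_tsum_sum_range {f : ℕ → ℂ} (hf : Summable f) (N : ℕ) [NeZero N] :
    ∑' n, f n = ∑' m, ∑ j ∈ range N, f (N * m + j) := by
  have h : Summable fun x : ℕ × Fin N => f ((Nat.divModEquiv N).symm x) :=
    (Nat.divModEquiv N).symm.summable_iff.mpr hf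
  rw [← (Nat.divModEquiv N).symm.tsum_eq, h.tsum_prod]
  refine tsum_congr fun m => ?_
  rw [tsum_fintype, ← Fin.sum_univ_eq_sum_range (fun j => f (N * m + j))]
  exact sum_congr rfl fun j _ => by simp [Nat.divModEquiv, mul_comm]

theorem hasSum_baileyWeight_quadProd_div {q X : ℂ} (hq : ‖q‖ < 1) {u : ℕ → ℂ} (h0 : u 0 = 0)
    (h1 : u 1 = 1) (hu : ∀ r, u (r + 2) = X * u (r + 1) - u r) (hb : ∀ r, ‖u r‖ ≤ 1) :
    HasSum (fun n => baileyWeight q n *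
        (quadProd X q n / (qPoch q q (2 * n + 1) * (1 + q ^ (n + 1)))))
      (∑' r, (q ^ (r ^ 2 + r) * (u (r + 1) + u r) - q ^ (r ^ 2) * u r)) := by
  have hpos : 0 < 1 - ‖q‖ := by linarith
  have hdiv : ∀ r s, ‖u r / (1 + q ^ s)‖ ≤ (1 - ‖q‖)⁻¹ := fun r s => by
    rw [norm_div, ← one_div]
    exact div_le_div₀ zero_le_one (hb r) hpos (one_sub_norm_le_norm_one_add_pow hq s)
  have hpow : ∀ n, ‖q ^ n‖ ≤ 1 := fun n => by
    rw [norm_pow]; exact pow_le_one₀ (norm_nonneg _) hq.le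
  have hγ : ∀ r, ‖u (r + 1) / (1 + q ^ (r + 1)) + q ^ r * u r / (1 + q ^ r)‖ ≤
      (1 - ‖q‖)⁻¹ + 1 * (1 - ‖q‖)⁻¹ := fun r => by
    refine (norm_add_le _ _).trans (add_le_add (hdiv _ _) ?_)
    rw [mul_div_assoc, norm_mul]
    exact mul_le_mul (hpow r) (hdiv _ _) (norm_nonneg _) zero_le_one
  have key := bailey_lemma hq (α := fun r => (-1) ^ r * q ^ (r * (r + 1) / 2) *
    (u (r + 1) / (1 + q ^ (r + 1)) + q ^ r * u r / (1 + q ^ r))) (fun r => by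
      rw [norm_mul, norm_mul, norm_pow (-1 : ℂ), norm_neg, norm_one, one_pow, one_mul]
      exact mul_le_mul (hpow _) (hγ r) (norm_nonneg _) zero_le_one)
    (sum_baileyKernel_eq_quadProd_div hq h0 h1 hu)
  refine (congrArg (HasSum _) ?_).mp key
  have hα : ∀ r : ℕ, (-1) ^ r * q ^ (r * (r + 1) / 2) * ((-1) ^ r * q ^ (r * (r + 1) / 2) *
      (u (r + 1) / (1 + q ^ (r + 1)) + q ^ r * u r / (1 + q ^ r))) =
      q ^ (r ^ 2 + r) * (u (r + 1) / (1 + q ^ (r + 1)) + q ^ r * u r / (1 + q ^ r)) := fun r => by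
    rw [← two_mul_triangle, two_mul, pow_add]
    linear_combination (q ^ (r * (r + 1) / 2) * q ^ (r * (r + 1) / 2) *
      (u (r + 1) / (1 + q ^ (r + 1)) + q ^ r * u r / (1 + q ^ r))) *
      neg_one_pow_mul_neg_one_pow r
  have hK : Summable fun r => q ^ (r ^ 2) * (u r / (1 + q ^ r)) :=
    summable_pow_mul_of_bounded hq (fun r => Nat.le_self_pow two_ne_zero r) (fun r => hdiv r r)
  have hK' := (summable_nat_add_iff 1).mpr hK
  have hS : Summable fun r : ℕ =>
      q ^ (r ^ 2 + r) * (u (r + 1) / (1 + q ^ (r + 1)) + q ^ r * u r / (1 + q ^ r)) :=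
    summable_pow_mul_of_bounded hq (fun r => Nat.le_add_left _ _) hγ
  have htel := hK.tsum_eq_zero_add
  rw [h0, zero_div, mul_zero, zero_add] at htel
  rw [tsum_congr hα]
  -- Adding the telescoping difference of q^{r^2} u_r/(1 + q^r), whose total is zero because u 0 =
  -- 0, clears the denominators.
  have e : ∀ r : ℕ, q ^ (r ^ 2 + r) * (u (r + 1) + u r) - q ^ (r ^ 2) * u r =
      q ^ (r ^ 2 + r) * (u (r + 1) / (1 + q ^ (r + 1)) + q ^ r * u r / (1 + q ^ r)) +
      (q ^ ((r + 1) ^ 2) * (u (r + 1) / (1 + q ^ (r + 1))) -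
        q ^ (r ^ 2) * (u r / (1 + q ^ r))) := fun r => by
    have hn1 := one_add_pow_ne_zero hq (r + 1)
    have hn2 := one_add_pow_ne_zero hq r
    field_simp
    ring
  rw [tsum_congr e, hS.tsum_add (hK'.sub hK), hK'.tsum_sub hK, ← htel, sub_self, add_zero]

theorem summable_quadProd_series {q : ℂ} (hq : ‖q‖ < 1) {u : ℕ → ℂ} (hb : ∀ r, ‖u r‖ ≤ 1) :
    Summable fun r : ℕ => q ^ (r ^ 2 + r) * (u (r + 1) + u r) - q ^ (r ^ 2) * u r :=
  (summable_pow_mul_of_bounded hq (fun _ => Nat.le_add_left _ _) (C := 1 + 1)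
    fun _ => (norm_add_le _ _).trans (add_le_add (hb _) (hb _))).sub
  (summable_pow_mul_of_bounded hq (fun r => Nat.le_self_pow two_ne_zero r) hb)

/-- At q = 0 the negative power is 0 by convention, and a, b > 0 make both sides 0, matching the
stated reading of these terms. -/
theorem pow_mul_one_sub_zpow_neg (q : ℂ) {a b : ℕ} {c : ℤ} (h : (b : ℤ) = a + c) (hc : c < 0)
    (hb : b ≠ 0) : q ^ a * (1 - q ^ c) = q ^ a - q ^ b := by
  rcases eq_or_ne q 0 with rfl | hq
  · rw [zero_pow (show a ≠ 0 by omega), zero_pow hb]; simp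
  · rw [mul_sub, mul_one, ← zpow_natCast q b, h, zpow_add₀ hq, zpow_natCast]

/-- This is (1 - q^k)(1 + q^k + q^{2k}) = 1 - q^{3k}, factor by factor. -/
theorem qPoch_cube (q : ℂ) (n : ℕ) :
    qPoch (q ^ 3) (q ^ 3) n = qPoch q q n * quadProd (-1) q n := by
  induction n with
  | zero => simp [qPoch, quadProd]
  | succ n ih => rw [qPoch_succ, qPoch_self_succ, quadProd_succ, ih]; ring

theorem qPoch_neg_sq (q : ℂ) (n : ℕ) : qPoch (-q ^ 2) (q ^ 2) n = quadProd 0 q n := by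
  induction n with
  | zero => simp [qPoch, quadProd]
  | succ n ih => rw [qPoch_succ, quadProd_succ, ih]; ring

theorem qPoch_neg_mul_self (q : ℂ) (n : ℕ) : qPoch (-q) q n ^ 2 = quadProd (-2) q n := by
  induction n with
  | zero => simp [qPoch, quadProd]
  | succ n ih => rw [qPoch_succ, quadProd_succ, ← ih]; ring

/-- Odd and even factors of (q;q)_{2n+1} separate, and (q^2;q^2)_n = (q;q)_n (-q;q)_n. -/
theorem qPoch_odd_mul (q : ℂ) (n : ℕ) :
    qPoch q (q ^ 2) (n + 1) * (qPoch q q n * qPoch (-q) q n) = qPoch q q (2 * n + 1) := by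
  induction n with
  | zero => simp [qPoch]
  | succ n ih =>
    rw [show 2 * (n + 1) + 1 = 2 * n + 1 + 1 + 1 by ring,
      qPoch_self_succ q (2 * n + 1 + 1), qPoch_self_succ q (2 * n + 1), ← ih,
      qPoch_succ _ _ (n + 1), qPoch_self_succ q n, qPoch_succ (-q) _ n]
    ring

theorem qPoch_self_even_succ (q : ℂ) (n : ℕ) :
    qPoch q q (2 * n + 2) = qPoch q q (2 * n + 1) * (1 + q ^ (n + 1)) * (1 - q ^ (n + 1)) := by
  rw [qPoch_self_succ]; ring

theorem qPoch_neg_self_ne_zero {q : ℂ} (hq : ‖q‖ < 1) (n : ℕ) : qPoch (-q) q n ≠ 0 := by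
  induction n with
  | zero => simp [qPoch]
  | succ n ih =>
    rw [qPoch_succ]
    refine mul_ne_zero ih ?_
    have := one_add_pow_ne_zero hq (n + 1)
    rwa [pow_succ', ← sub_neg_eq_add, ← neg_mul] at this

/-! ### The four identities -/

theorem false_theta_cubic {q : ℂ} (hq : ‖q‖ < 1) :
    HasSum (fun n : ℕ => (1 - q ^ (n + 1)) * qPoch (q ^ 3) (q ^ 3) n * (-1) ^ n *
          q ^ (n * (n + 1) / 2) / qPoch q q (2 * n + 2))
      (∑' m : ℕ, (q ^ (9 * m ^ 2 + 3 * m) - q ^ (9 * m ^ 2 + 15 * m + 6) +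
        (q ^ (9 * m ^ 2 + 12 * m + 4) - q ^ (9 * m ^ 2 + 6 * m + 1)))) := by
  -- The values of (x^r - x^{-r})/(x - x^{-1}) at a primitive cube root of unity, where X = -1.
  set u : ℕ → ℂ := fun r => if r % 3 = 0 then 0 else if r % 3 = 1 then 1 else -1 with hu
  have hb : ∀ r, ‖u r‖ ≤ 1 := fun r => by
    simp only [hu]; split_ifs <;> simp
  have hrec : ∀ r, u (r + 2) = -1 * u (r + 1) - u r := fun r => by
    have : r % 3 = 0 ∨ r % 3 = 1 ∨ r % 3 = 2 := by omega
    rcases this with h | h | h <;> simp [hu, Nat.add_mod, h]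
  have key := hasSum_baileyWeight_quadProd_div hq (by simp [hu]) (by simp [hu]) hrec hb
  rw [tsum_eq_tsum_sum_range (summable_quadProd_series hq hb) 3] at key
  convert key using 1
  · ext n
    rw [qPoch_cube, qPoch_self_even_succ, baileyWeight]
    have h1 := one_sub_pow_ne_zero hq n
    have h2 := one_add_pow_ne_zero hq (n + 1)
    have h3 := qPoch_self_ne_zero hq (2 * n + 1)
    field_simp
  · refine tsum_congr fun m => ?_
    simp only [sum_range_succ, range_zero, sum_empty, hu]
    simp [Nat.add_mod, Nat.mul_mod_right]
    ring

theorem false_theta_quartic {q : ℂ} (hq : ‖q‖ < 1) :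
    HasSum (fun n : ℕ => qPoch q q (n + 1) * qPoch (-q ^ 2) (q ^ 2) n * (-1) ^ n *
          q ^ ((n ^ 2 + n) / 2) / qPoch q q (2 * n + 2))
      (∑' m : ℕ, (q ^ (16 * m ^ 2 + 4 * m) - q ^ (16 * m ^ 2 + 28 * m + 12) -
        (q ^ (16 * m ^ 2 + 8 * m + 1) - q ^ (16 * m ^ 2 + 24 * m + 9)) +
        (q ^ (16 * m ^ 2 + 12 * m + 2) - q ^ (16 * m ^ 2 + 20 * m + 6)))) := by
  -- The same quotient at x = i, where X = 0.
  set u : ℕ → ℂ := fun r => if r % 4 = 1 then 1 else if r % 4 = 3 then -1 else 0 with hu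
  have hb : ∀ r, ‖u r‖ ≤ 1 := fun r => by
    simp only [hu]; split_ifs <;> simp
  have hrec : ∀ r, u (r + 2) = 0 * u (r + 1) - u r := fun r => by
    have : r % 4 = 0 ∨ r % 4 = 1 ∨ r % 4 = 2 ∨ r % 4 = 3 := by omega
    rcases this with h | h | h | h <;> simp [hu, Nat.add_mod, h]
  have key := hasSum_baileyWeight_quadProd_div hq (by simp [hu]) (by simp [hu]) hrec hb
  rw [tsum_eq_tsum_sum_range (summable_quadProd_series hq hb) 4] at key
  convert key using 1
  · ext n
    rw [qPoch_neg_sq, qPoch_self_even_succ, baileyWeight, qPoch_self_succ,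
      show n ^ 2 + n = n * (n + 1) by ring]
    have h1 := one_sub_pow_ne_zero hq n
    have h2 := one_add_pow_ne_zero hq (n + 1)
    have h3 := qPoch_self_ne_zero hq (2 * n + 1)
    field_simp
  · refine tsum_congr fun m => ?_
    simp only [sum_range_succ, range_zero, sum_empty, hu]
    simp [Nat.add_mod, Nat.mul_mod_right]
    ring

theorem false_theta_quintic {q : ℂ} (hq : ‖q‖ < 1) :
    HasSum (fun n : ℕ => (-1) ^ n * q ^ (n ^ 2 + n) / qPoch (-q) q (2 * n))
      (∑' m : ℕ, (q ^ (10 * m ^ 2 + m) - q ^ (10 * m ^ 2 + 19 * m + 9) +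
        (q ^ (10 * m ^ 2 + 11 * m + 3) - q ^ (10 * m ^ 2 + 9 * m + 2)))) := by
  have hq2 : ‖q ^ 2‖ < 1 := by
    rw [norm_pow]; exact pow_lt_one₀ (norm_nonneg _) hq (by norm_num)
  have hpow : ∀ n, ‖q ^ n‖ ≤ 1 := fun n => by
    rw [norm_pow]; exact pow_le_one₀ (norm_nonneg _) hq.le
  have hsub : ∀ n, ‖1 - q ^ n‖ ≤ 1 + 1 := fun n =>
    (norm_sub_le _ _).trans (add_le_add norm_one.le (hpow n))
  -- Base q^2 with p = q: the weight's (q^2;q^2)_n cancels against β_n, and the α side has exponent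
  -- (5r^2 + r)/2, split by parity of r.
  have key := bailey_lemma hq2
    (α := fun r => (-1) ^ r * q ^ pentNum r * (1 - q ^ (4 * r + 2))) (fun r => by
      rw [norm_mul, norm_mul, norm_pow (-1 : ℂ), norm_neg, norm_one, one_pow, one_mul]
      exact mul_le_mul (hpow _) (hsub _) (norm_nonneg _) zero_le_one)
    (sum_baileyKernel_eq_pentagonal hq)
  have hα : ∀ r : ℕ, (-1) ^ r * (q ^ 2) ^ (r * (r + 1) / 2) *
      ((-1) ^ r * q ^ pentNum r * (1 - q ^ (4 * r + 2))) =
      q ^ (r ^ 2 + r + pentNum r) * (1 - q ^ (4 * r + 2)) := fun r => by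
    rw [← pow_mul, two_mul_triangle, pow_add _ (r ^ 2 + r)]
    linear_combination q ^ (r ^ 2 + r) * q ^ pentNum r * (1 - q ^ (4 * r + 2)) *
      neg_one_pow_mul_neg_one_pow r
  rw [tsum_congr hα, tsum_eq_tsum_sum_range (summable_pow_mul_of_bounded hq
    (fun r => by have := Nat.zero_le (r ^ 2); omega) fun r => hsub _) 2] at key
  convert key using 1
  · ext n
    rw [baileyWeight, ← pow_mul, two_mul_triangle]
    have h1 := qPoch_self_ne_zero hq2 n
    have h2 := qPoch_neg_self_ne_zero hq (2 * n)
    field_simp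
  · refine tsum_congr fun m => ?_
    simp only [sum_range_succ, range_zero, sum_empty, zero_add, add_zero]
    have e1 : (2 * m) ^ 2 + 2 * m + pentNum (2 * m) = 10 * m ^ 2 + m := by
      have := two_mul_pentNum (2 * m)
      nlinarith
    have e2 : (2 * m + 1) ^ 2 + (2 * m + 1) + pentNum (2 * m + 1) = 10 * m ^ 2 + 11 * m + 3 := by
      have := two_mul_pentNum (2 * m + 1)
      nlinarith
    rw [e1, e2]
    ring

theorem false_theta_triangular {q : ℂ} (hq : ‖q‖ < 1) :
    HasSum (fun n : ℕ => qPoch (-q) q n * q ^ (n * (n + 1) / 2) * (-1) ^ n /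
          qPoch q (q ^ 2) (n + 1))
      (∑' r : ℕ, (-1) ^ r * q ^ (r ^ 2 + r)) := by
  have key := bailey_lemma hq
    (α := fun r => (-1) ^ r * q ^ (r * (r + 1) / 2) * (-1) ^ r) (A := 1) (fun r => by
      simp only [norm_mul, norm_pow, norm_neg, norm_one, one_pow, one_mul, mul_one]
      exact pow_le_one₀ (norm_nonneg _) hq.le)
    (sum_baileyKernel_eq_quadProd hq (X := -2) (d := fun r => (-1) ^ r) (by simp) (by norm_num)
      (fun r => by ring))
  convert key using 1
  · ext n
    rw [← qPoch_odd_mul, ← qPoch_neg_mul_self, baileyWeight]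
    have h1 := qPoch_self_ne_zero hq n
    have h2 := qPoch_neg_self_ne_zero hq n
    have h3 : qPoch q (q ^ 2) (n + 1) ≠ 0 := fun h => by
      have := qPoch_self_ne_zero hq (2 * n + 1)
      rw [← qPoch_odd_mul, h, zero_mul] at this
      exact this rfl
    field_simp
  · refine tsum_congr fun r => ?_
    rw [← two_mul_triangle, two_mul, pow_add]
    linear_combination -((-1 : ℂ) ^ r * q ^ (r * (r + 1) / 2) * q ^ (r * (r + 1) / 2)) *
      neg_one_pow_mul_neg_one_pow r

/-- In ℂ, `Summable` is equivalent to absolute convergence. -/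
theorem corollary3p7 (q : ℂ) (hq : ‖q‖ < 1) :
    -- first identity
    ((Summable fun n : ℕ => (1 - q ^ (n + 1)) * qPoch (q ^ 3) (q ^ 3) n * (-1) ^ n *
          q ^ (n * (n + 1) / 2) / qPoch q q (2 * n + 2)) ∧
      (Summable fun r : ℕ => q ^ (9 * r ^ 2 + 3 * r) * (1 - q ^ (12 * r + 6))) ∧
      (Summable fun r : ℕ =>
          q ^ (9 * r ^ 2 + 12 * r + 4) * (1 - q ^ (-6 * (r : ℤ) - 3))) ∧
      ∑' n : ℕ, (1 - q ^ (n + 1)) * qPoch (q ^ 3) (q ^ 3) n * (-1) ^ n *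
          q ^ (n * (n + 1) / 2) / qPoch q q (2 * n + 2) =
        ∑' r : ℕ, q ^ (9 * r ^ 2 + 3 * r) * (1 - q ^ (12 * r + 6)) +
        ∑' r : ℕ, q ^ (9 * r ^ 2 + 12 * r + 4) * (1 - q ^ (-6 * (r : ℤ) - 3))) ∧
    -- second identity
    ((Summable fun n : ℕ => (-1) ^ n * q ^ (n ^ 2 + n) / qPoch (-q) q (2 * n)) ∧
      (Summable fun r : ℕ => q ^ (10 * r ^ 2 + r) * (1 - q ^ (18 * r + 9))) ∧
      (Summable fun r : ℕ =>
          q ^ (10 * r ^ 2 + 11 * r + 3) * (1 - q ^ (-2 * (r : ℤ) - 1))) ∧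
      ∑' n : ℕ, (-1) ^ n * q ^ (n ^ 2 + n) / qPoch (-q) q (2 * n) =
        ∑' r : ℕ, q ^ (10 * r ^ 2 + r) * (1 - q ^ (18 * r + 9)) +
        ∑' r : ℕ, q ^ (10 * r ^ 2 + 11 * r + 3) * (1 - q ^ (-2 * (r : ℤ) - 1))) ∧
    -- third identity
    ((Summable fun n : ℕ => qPoch q q (n + 1) * qPoch (-q ^ 2) (q ^ 2) n * (-1) ^ n *
          q ^ ((n ^ 2 + n) / 2) / qPoch q q (2 * n + 2)) ∧
      (Summable fun r : ℕ => q ^ (16 * r ^ 2 + 4 * r) * (1 - q ^ (24 * r + 12))) ∧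
      (Summable fun r : ℕ => q ^ (16 * r ^ 2 + 8 * r + 1) * (1 - q ^ (16 * r + 8))) ∧
      (Summable fun r : ℕ => q ^ (16 * r ^ 2 + 12 * r + 2) * (1 - q ^ (8 * r + 4))) ∧
      ∑' n : ℕ, qPoch q q (n + 1) * qPoch (-q ^ 2) (q ^ 2) n * (-1) ^ n *
          q ^ ((n ^ 2 + n) / 2) / qPoch q q (2 * n + 2) =
        ∑' r : ℕ, q ^ (16 * r ^ 2 + 4 * r) * (1 - q ^ (24 * r + 12)) -
        ∑' r : ℕ, q ^ (16 * r ^ 2 + 8 * r + 1) * (1 - q ^ (16 * r + 8)) +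
        ∑' r : ℕ, q ^ (16 * r ^ 2 + 12 * r + 2) * (1 - q ^ (8 * r + 4))) ∧
    -- fourth identity
    ((Summable fun n : ℕ => qPoch (-q) q n * q ^ (n * (n + 1) / 2) * (-1) ^ n /
          qPoch q (q ^ 2) (n + 1)) ∧
      (Summable fun r : ℕ => (-1) ^ r * q ^ (r ^ 2 + r)) ∧
      ∑' n : ℕ, qPoch (-q) q n * q ^ (n * (n + 1) / 2) * (-1) ^ n /
          qPoch q (q ^ 2) (n + 1) =
        ∑' r : ℕ, (-1) ^ r * q ^ (r ^ 2 + r)) := by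
  have hs : ∀ {e : ℕ → ℕ}, (∀ r, r ≤ e r) → Summable fun r => q ^ e r :=
    fun h => summable_pow_of_le hq h
  have hz1 : ∀ r : ℕ, q ^ (9 * r ^ 2 + 12 * r + 4) * (1 - q ^ (-6 * (r : ℤ) - 3)) =
      q ^ (9 * r ^ 2 + 12 * r + 4) - q ^ (9 * r ^ 2 + 6 * r + 1) := fun r =>
    pow_mul_one_sub_zpow_neg q (by push_cast; ring) (by omega) (by omega)
  have hz2 : ∀ r : ℕ, q ^ (10 * r ^ 2 + 11 * r + 3) * (1 - q ^ (-2 * (r : ℤ) - 1)) =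
      q ^ (10 * r ^ 2 + 11 * r + 3) - q ^ (10 * r ^ 2 + 9 * r + 2) := fun r =>
    pow_mul_one_sub_zpow_neg q (by push_cast; ring) (by omega) (by omega)
  have hm : ∀ {a b c : ℕ}, a + b = c → q ^ a * (1 - q ^ b) = q ^ a - q ^ c := fun h => by
    rw [← h, pow_add]; ring
  have h1 : ∀ r : ℕ, q ^ (9 * r ^ 2 + 3 * r) * (1 - q ^ (12 * r + 6)) =
      q ^ (9 * r ^ 2 + 3 * r) - q ^ (9 * r ^ 2 + 15 * r + 6) := fun r => hm (by ring)
  have h2 : ∀ r : ℕ, q ^ (10 * r ^ 2 + r) * (1 - q ^ (18 * r + 9)) =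
      q ^ (10 * r ^ 2 + r) - q ^ (10 * r ^ 2 + 19 * r + 9) := fun r => hm (by ring)
  have h3 : ∀ r : ℕ, q ^ (16 * r ^ 2 + 4 * r) * (1 - q ^ (24 * r + 12)) =
      q ^ (16 * r ^ 2 + 4 * r) - q ^ (16 * r ^ 2 + 28 * r + 12) := fun r => hm (by ring)
  have h4 : ∀ r : ℕ, q ^ (16 * r ^ 2 + 8 * r + 1) * (1 - q ^ (16 * r + 8)) =
      q ^ (16 * r ^ 2 + 8 * r + 1) - q ^ (16 * r ^ 2 + 24 * r + 9) := fun r => hm (by ring)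
  have h5 : ∀ r : ℕ, q ^ (16 * r ^ 2 + 12 * r + 2) * (1 - q ^ (8 * r + 4)) =
      q ^ (16 * r ^ 2 + 12 * r + 2) - q ^ (16 * r ^ 2 + 20 * r + 6) := fun r => hm (by ring)
  simp only [hz1, hz2, h1, h2, h3, h4, h5]
  have s1 : Summable fun r : ℕ => q ^ (9 * r ^ 2 + 3 * r) - q ^ (9 * r ^ 2 + 15 * r + 6) :=
    (hs fun r => by omega).sub (hs fun r => by omega)
  have s2 : Summable fun r : ℕ => q ^ (9 * r ^ 2 + 12 * r + 4) - q ^ (9 * r ^ 2 + 6 * r + 1) :=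
    (hs fun r => by omega).sub (hs fun r => by omega)
  have s3 : Summable fun r : ℕ => q ^ (10 * r ^ 2 + r) - q ^ (10 * r ^ 2 + 19 * r + 9) :=
    (hs fun r => by omega).sub (hs fun r => by omega)
  have s4 : Summable fun r : ℕ => q ^ (10 * r ^ 2 + 11 * r + 3) - q ^ (10 * r ^ 2 + 9 * r + 2) :=
    (hs fun r => by omega).sub (hs fun r => by omega)
  have s5 : Summable fun r : ℕ => q ^ (16 * r ^ 2 + 4 * r) - q ^ (16 * r ^ 2 + 28 * r + 12) :=
    (hs fun r => by omega).sub (hs fun r => by omega)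
  have s6 : Summable fun r : ℕ => q ^ (16 * r ^ 2 + 8 * r + 1) - q ^ (16 * r ^ 2 + 24 * r + 9) :=
    (hs fun r => by omega).sub (hs fun r => by omega)
  have s7 : Summable fun r : ℕ => q ^ (16 * r ^ 2 + 12 * r + 2) - q ^ (16 * r ^ 2 + 20 * r + 6) :=
    (hs fun r => by omega).sub (hs fun r => by omega)
  have s8 : Summable fun r : ℕ => (-1) ^ r * q ^ (r ^ 2 + r) :=
    (summable_pow_mul_of_bounded hq (fun r => Nat.le_add_left r (r ^ 2))
      (c := fun r => (-1) ^ r) (C := 1) (by simp)).congr fun r => mul_comm _ _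
  refine ⟨⟨(false_theta_cubic hq).summable, s1, s2, ?_⟩,
    ⟨(false_theta_quintic hq).summable, s3, s4, ?_⟩,
    ⟨(false_theta_quartic hq).summable, s5, s6, s7, ?_⟩,
    (false_theta_triangular hq).summable, s8, (false_theta_triangular hq).tsum_eq⟩
  · rw [(false_theta_cubic hq).tsum_eq, s1.tsum_add s2]
  · rw [(false_theta_quintic hq).tsum_eq, s3.tsum_add s4]
  · rw [(false_theta_quartic hq).tsum_eq, (s5.sub s6).tsum_add s7, s5.tsum_sub s6]
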